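/- **Setting.** Let $\Omega$ be a non-empty set and let $\ge_*$ be a reflexive, transitive relation on $\mathbb R^\Omega$; write $f>_*g$ if $f\ge_*g$ but not $g\ge_*f$. Assume: $1>_*0$; $f\ge g$ pointwise implies $f\ge_*g$; $f\ge_*g$ implies $bf+h\ge_*bg+h$ for all bounded $b\ge0$ and all $h\in\mathbb R^\Omega$; $f>_*0$ implies $f\wedge1>_*0$. A set $A\subset\Omega$ is negligible if $0\ge_*\mathbf 1_A$. Let $\mathcal X\subset\mathbb R^\Omega$ be convex, with $0,1\in\mathcal X$, such that each $X\in\mathcal X$ satisfies $X\ge_*a$ for some $a\in\mathbb R$, and $X+\lambda\in\mathcal X$ for $X\in\mathcal X$, $\lambda\ge0$. A *pricing functional* on a set $D\subset\mathbb R^\Omega$ is a map $\rho:D\to\mathbb R$ with $\rho(1)=1$ that is positively homogeneous, subadditive (both whenever the functions involved lie in $D$) and $\ge_*$-monotone. It is *arbitrage free* on $A\subset D$ if $\rho(f)>0$ for all $f\in A$ with $f>_*0$, and a *price function* on $D$ if it is arbitrage free on $D$. It is *cash additive* on $D$ if $\rho(f+a)=\rho(f)+a$ whenever $f,f+a\in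 D$, $a\in\mathbb R$. Let $\pi$ be a price function on $\mathcal X$. Let $\mathcal X_1=\{X\wedge k:X\in\mathcal X,\ k\in[0,+\infty]\}$ and $L(\mathcal X)=\{g\in\mathbb R^\Omega:\lambda X\ge_*|g|\text{ for some }\lambda>0,\ X\in\mathcal X\}$. Let $\mathcal M_0(\pi)$ be the set of finitely additive probabilities $m$ on the power set of $\Omega$ that vanish on negligible sets and satisfy $L(\mathcal X)\subset L^1(m)$ and $\int X\,dm\le\pi(X)$ for all $X\in\mathcal X$. Let $\mathcal M(\pi;\mathcal X_1)$ be the set of $m\in\mathcal M_0(\pi)$ with $\int (f\wedge1)\,dm>0$ for all $f\in\mathcal X_1$ with $f>_*0$. For a pricing functional $\rho$ on $D\supset\mathcal X_1$ let $$\mathfrak m(\rho;\mathcal X_1)=\sup\frac{\sum_{i\le N}\rho(f_i)-\rho\big(\sum_{i\le N}f_i\big)}{\sum_{i\le N}\rho(f_i)}\qquad(0/0=0),$$ the supremum being over all finite families $f_1,\dots,f_N\in\mathcal X_1$ with $\sum_if_i\in D$ such that, for each $i$, $c_i\ge_*f_i\ge_*0$ for some constant $c_i$. **Statement.** (1) If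 $\mathcal X_1$ is convex, then $\mathcal M(\pi;\mathcal X_1)\neq\emptyset$ if and only if there is a cash additive price function $\rho_1$ on $\mathcal X_1$ with $\rho_1\le\pi$ on $\mathcal X$ and $\mathfrak m(\rho_1;\mathcal X_1)<1$. (2) In general, $\mathcal M(\pi;\mathcal X_1)\neq\emptyset$ if and only if there is a cash additive pricing functional $\rho_1$ on the convex hull of $\mathcal X_1$ that is arbitrage free on $\mathcal X_1$ and satisfies $\rho_1\le\pi$ on $\mathcal X$ and $\mathfrak m(\rho_1;\mathcal X_1)<1$. -/

import Mathlib

open MeasureTheory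

namespace CommonOrderMarket

variable {Ω : Type*}

/-- The strict (asymmetric) part of a binary relation `ge` on payoffs. -/
def Gt (ge : (Ω → ℝ) → (Ω → ℝ) → Prop) (f g : Ω → ℝ) : Prop :=
  ge f g ∧ ¬ ge g f

/-- A common order `f ≥_* g` on real functions on `Ω` (criterion of collective rationality). -/
structure IsCommonOrder (ge : (Ω → ℝ) → (Ω → ℝ) → Prop) : Prop where
  refl : ∀ f, ge f f
  trans : ∀ f g h, ge f g → ge g h → ge f h
  one_gt_zero : Gt ge 1 0
  mono : ∀ f g : Ω → ℝ, (∀ ω, g ω ≤ f ω) → ge f g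
  affine : ∀ f g : Ω → ℝ, ge f g → ∀ b : Ω → ℝ, (∀ ω, 0 ≤ b ω) → (∃ c : ℝ, ∀ ω, b ω ≤ c) →
    ∀ h : Ω → ℝ, ge (b * f + h) (b * g + h)
  trunc : ∀ f : Ω → ℝ, Gt ge f 0 → Gt ge (f ⊓ 1) 0

/-- The negligible sets: those `A` with `0 ≥_* 1_A`. -/
def negligible (ge : (Ω → ℝ) → (Ω → ℝ) → Prop) : Set (Set Ω) :=
  {A | ge 0 (A.indicator 1)}

/-- The admissible sets of traded payoffs. -/
structure IsAssetSet (ge : (Ω → ℝ) → (Ω → ℝ) → Prop) (X : Set (Ω → ℝ)) : Prop where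
  convex : Convex ℝ X
  zero_mem : (0 : Ω → ℝ) ∈ X
  one_mem : (1 : Ω → ℝ) ∈ X
  bounded_below : ∀ f ∈ X, ∃ a : ℝ, ge f (fun _ => a)
  add_const_mem : ∀ f ∈ X, ∀ a : ℝ, 0 ≤ a → (fun ω => f ω + a) ∈ X

/-- The call-overwriting payoffs `X ∧ k`, `k ∈ [0, +∞]`. -/
def callOverwriting (X : Set (Ω → ℝ)) : Set (Ω → ℝ) :=
  {f | f ∈ X ∨ ∃ g ∈ X, ∃ k : ℝ, 0 ≤ k ∧ f = fun ω => min (g ω) k}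

/-- The superhedgeable claims `L(X)`. -/
def superhedgeable (ge : (Ω → ℝ) → (Ω → ℝ) → Prop) (X : Set (Ω → ℝ)) : Set (Ω → ℝ) :=
  {g | ∃ l : ℝ, 0 < l ∧ ∃ f ∈ X, ge (l • f) (fun ω => |g ω|)}

/-- Normalised, positively homogeneous, subadditive, `≥_*`-monotone functionals on `D`. Only the
values of `p` on `D` matter. -/
structure IsPricing (ge : (Ω → ℝ) → (Ω → ℝ) → Prop) (D : Set (Ω → ℝ))
    (p : (Ω → ℝ) → ℝ) : Prop where
  map_one : p 1 = 1
  pos_hom : ∀ f ∈ D, ∀ l : ℝ, 0 ≤ l → l • f ∈ D → p (l • f) = l * p f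
  subadd : ∀ f ∈ D, ∀ g ∈ D, f + g ∈ D → p (f + g) ≤ p f + p g
  mono : ∀ f ∈ D, ∀ g ∈ D, ge f g → p g ≤ p f

/-- Absence of arbitrage on the set `A` of assets. -/
def NoArbitrage (ge : (Ω → ℝ) → (Ω → ℝ) → Prop) (A : Set (Ω → ℝ)) (p : (Ω → ℝ) → ℝ) : Prop :=
  ∀ f ∈ A, Gt ge f 0 → 0 < p f

/-- Price functions on `D`: the arbitrage-free pricing functionals. -/
def IsPrice (ge : (Ω → ℝ) → (Ω → ℝ) → Prop) (D : Set (Ω → ℝ)) (p : (Ω → ℝ) → ℝ) : Prop :=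
  IsPricing ge D p ∧ NoArbitrage ge D p

/-- Cash additivity on `D`. -/
def CashAdditive (D : Set (Ω → ℝ)) (p : (Ω → ℝ) → ℝ) : Prop :=
  ∀ f ∈ D, ∀ a : ℝ, (fun ω => f ω + a) ∈ D → p (fun ω => f ω + a) = p f + a

/-! ### Finitely additive probabilities on the power set and their integral -/

/-- `m` is a finitely additive probability on the power set of `Ω`. -/
def IsFinAddProb (m : AddContent ℝ (Set.univ : Set (Set Ω))) : Prop :=
  (∀ A, 0 ≤ m A) ∧ m Set.univ = 1

/-- Integral of a function with finite range. -/
noncomputable def simpleIntegral (m : AddContent ℝ (Set.univ : Set (Set Ω))) (s : Ω → ℝ) : ℝ :=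
  ∑ᶠ c : ℝ, c * m (s ⁻¹' {c})

/-- The integrals of the nonnegative simple functions below `f`. -/
def lowerSums (m : AddContent ℝ (Set.univ : Set (Set Ω))) (f : Ω → ℝ) : Set ℝ :=
  {r | ∃ s : Ω → ℝ, (Set.range s).Finite ∧ (∀ ω, 0 ≤ s ω) ∧ (∀ ω, s ω ≤ f ω) ∧
    r = simpleIntegral m s}

/-- `f ∈ L¹(m)`. On the power set there is no measurability condition, and a function is in `L¹(m)`
exactly when the integrals of the simple functions below `|f|` are bounded. -/
def IntegrableFA (m : AddContent ℝ (Set.univ : Set (Set Ω))) (f : Ω → ℝ) : Prop :=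
  BddAbove (lowerSums m fun ω => |f ω|)

/-- The integral of `f ∈ L¹(m)`: positive part minus negative part. -/
noncomputable def integralFA (m : AddContent ℝ (Set.univ : Set (Set Ω))) (f : Ω → ℝ) : ℝ :=
  sSup (lowerSums m fun ω => max (f ω) 0) - sSup (lowerSums m fun ω => max (-f ω) 0)

/-- The pricing measures of `(X, ≥_*, p)`: finitely additive probabilities vanishing on negligible
sets, integrating `L(X)`, and dominated by `p` on `X`. -/
def pricingMeasures (ge : (Ω → ℝ) → (Ω → ℝ) → Prop) (X : Set (Ω → ℝ)) (p : (Ω → ℝ) → ℝ) :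
    Set (AddContent ℝ (Set.univ : Set (Set Ω))) :=
  {m | IsFinAddProb m ∧ (∀ A ∈ negligible ge, m A = 0) ∧
    (∀ g ∈ superhedgeable ge X, IntegrableFA m g) ∧ ∀ f ∈ X, integralFA m f ≤ p f}

/-- The pricing measures that are strictly positive on `A`. -/
def strictPricingMeasures (ge : (Ω → ℝ) → (Ω → ℝ) → Prop) (X : Set (Ω → ℝ)) (p : (Ω → ℝ) → ℝ)
    (A : Set (Ω → ℝ)) : Set (AddContent ℝ (Set.univ : Set (Set Ω))) :=
  {m ∈ pricingMeasures ge X p | ∀ f ∈ A, Gt ge f 0 → 0 < integralFA m (f ⊓ 1)}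

/-- The market power `ma(r; A)` of a functional `r` with domain `D ⊇ A`: the supremum of
`(∑ r(f_i) - r(∑ f_i)) / ∑ r(f_i)` (with `0 / 0 = 0`) over the finite families of `≥_*`-positive and
`≥_*`-bounded `f_i ∈ A` whose sum is in the domain. For a pricing functional on `D` the ratios lie
in `[0, 1]`, so that the supremum is a genuine one. -/
noncomputable def marketPower (ge : (Ω → ℝ) → (Ω → ℝ) → Prop) (D A : Set (Ω → ℝ))
    (r : (Ω → ℝ) → ℝ) : ℝ :=
  sSup {x | ∃ (N : ℕ) (f : Fin N → Ω → ℝ),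
    (∀ i, f i ∈ A ∧ ge (f i) 0 ∧ ∃ c : ℝ, ge (fun _ => c) (f i)) ∧ ∑ i, f i ∈ D ∧
    x = (∑ i, r (f i) - r (∑ i, f i)) / ∑ i, r (f i)}

end CommonOrderMarket

namespace CommonOrderMarket

variable {Ω : Type*}

/-! ### The integral of simple functions -/

section Integral

variable {m : AddContent ℝ (Set.univ : Set (Set Ω))}

/-! If `m` is a strictly positive pricing measure, its integral is linear on `L(X)`, so it is a cash
additive functional with market power zero.

Conversely, let `r` have market power `q < 1` and put `c = 1 - q > 0`. For positive bounded `f_i` in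
`callOverwriting X` whose sum lies in the domain, the definition of `q` says `c ∑ r(f_i) ≤ r(∑
f_i)`. Hence `c * r`, extended additively to positive combinations of such payoffs, stays below the
superhedging price generated by `r` and cash (`combinations_le`). A Hahn-Banach sandwich
(`exists_linearMap_le_of_cone`, `exists_linearMap_of_pricing`) yields a linear `φ`, positive on
`L(X)`, with `φ ≤ r` on `X` and `c * r ≤ φ` on the bounded positive payoffs.

Let `m` be the restriction of `φ` to indicators. The integral of `m` is a supremum over simple
functions, so it is at most `φ` on positive claims; the two may differ on unbounded claims, where
`φ` can carry a part that `m` does not see. The inequality is enough for `∫ X dm ≤ π(X)`, because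
payoffs are bounded below up to cash. Strict positivity only concerns `f ⊓ 1`, which is bounded:
there uniform approximation shows that nothing is lost, and `c * r (f ⊓ 1) > 0` by absence of
arbitrage. -/

lemma addContent_union_univ (m : AddContent ℝ (Set.univ : Set (Set Ω))) {A B : Set Ω}
    (h : Disjoint A B) : m (A ∪ B) = m A + m B :=
  addContent_union' (Set.mem_univ _) (Set.mem_univ _) (Set.mem_univ _) h

lemma simpleIntegral_eq_sum (m : AddContent ℝ (Set.univ : Set (Set Ω))) {s : Ω → ℝ}
    {F : Finset ℝ} (hF : Set.range s ⊆ F) :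
    simpleIntegral m s = ∑ c ∈ F, c * m (s ⁻¹' {c}) := by
  apply finsum_eq_sum_of_support_subset
  intro c hc
  apply hF
  by_contra hcr
  apply hc
  simp [Set.preimage_singleton_eq_empty.2 hcr]

/-- The operator valued set function whose elementary integral is `simpleIntegral`. -/
noncomputable def contentCLM (m : AddContent ℝ (Set.univ : Set (Set Ω))) (A : Set Ω) : ℝ →L[ℝ] ℝ :=
  m A • ContinuousLinearMap.id ℝ ℝ

lemma exists_simpleFunc {s : Ω → ℝ} (hs : (Set.range s).Finite) :
    ∃ f : @SimpleFunc Ω ⊤ ℝ, ⇑f = s :=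
  ⟨@SimpleFunc.mk Ω ⊤ ℝ s (fun _ => trivial) hs, rfl⟩

/-- With the σ-algebra `⊤`, the elementary integral for additive set functions applies, and
linearity and monotonicity are inherited from it. -/
lemma simpleIntegral_coe (f : @SimpleFunc Ω ⊤ ℝ) :
    simpleIntegral m f = f.setToSimpleFunc (contentCLM m) := by
  let _ : MeasurableSpace Ω := ⊤
  rw [simpleIntegral_eq_sum m (F := f.range) (by simp), SimpleFunc.setToSimpleFunc]
  refine Finset.sum_congr rfl fun c _ => ?_
  simp [contentCLM, mul_comm]

/-- The reference measure is `0`: every set then has finite measure and every simple function is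
integrable, so the side conditions disappear. -/
lemma finMeasAdditive_contentCLM :
    @FinMeasAdditive Ω _ _ ⊤ 0 (contentCLM m) := by
  intro A B _ _ _ _ h
  simp [contentCLM, addContent_union_univ m h, add_smul]

lemma simpleIntegral_add {s t : Ω → ℝ} (hs : (Set.range s).Finite) (ht : (Set.range t).Finite) :
    simpleIntegral m (s + t) = simpleIntegral m s + simpleIntegral m t := by
  let _ : MeasurableSpace Ω := ⊤
  obtain ⟨f, rfl⟩ := exists_simpleFunc hs
  obtain ⟨g, rfl⟩ := exists_simpleFunc ht
  rw [← SimpleFunc.coe_add, simpleIntegral_coe, simpleIntegral_coe, simpleIntegral_coe]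
  exact SimpleFunc.setToSimpleFunc_add _ finMeasAdditive_contentCLM
    integrable_zero_measure integrable_zero_measure

lemma simpleIntegral_smul {s : Ω → ℝ} (hs : (Set.range s).Finite) (l : ℝ) :
    simpleIntegral m (l • s) = l * simpleIntegral m s := by
  let _ : MeasurableSpace Ω := ⊤
  obtain ⟨f, rfl⟩ := exists_simpleFunc hs
  rw [← SimpleFunc.coe_smul, simpleIntegral_coe, simpleIntegral_coe]
  exact SimpleFunc.setToSimpleFunc_smul_real _ finMeasAdditive_contentCLM _
    integrable_zero_measure

lemma simpleIntegral_mono (hm : IsFinAddProb m) {s t : Ω → ℝ} (hs : (Set.range s).Finite)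
    (ht : (Set.range t).Finite) (hst : ∀ ω, s ω ≤ t ω) :
    simpleIntegral m s ≤ simpleIntegral m t := by
  let _ : MeasurableSpace Ω := ⊤
  obtain ⟨f, rfl⟩ := exists_simpleFunc hs
  obtain ⟨g, rfl⟩ := exists_simpleFunc ht
  rw [simpleIntegral_coe, simpleIntegral_coe]
  refine SimpleFunc.setToSimpleFunc_mono finMeasAdditive_contentCLM (fun A _ _ x hx => ?_)
    integrable_zero_measure integrable_zero_measure hst
  simpa [contentCLM] using mul_nonneg (hm.1 A) hx

lemma finite_range_const (c : ℝ) : (Set.range fun _ : Ω => c).Finite :=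
  (Set.finite_singleton c).subset (by rintro _ ⟨ω, rfl⟩; rfl)

lemma finite_range_add {s t : Ω → ℝ} (hs : (Set.range s).Finite) (ht : (Set.range t).Finite) :
    (Set.range (s + t)).Finite := by
  refine (hs.image2 (· + ·) ht).subset ?_
  rintro _ ⟨ω, rfl⟩
  exact ⟨_, ⟨ω, rfl⟩, _, ⟨ω, rfl⟩, rfl⟩

lemma finite_range_smul {s : Ω → ℝ} (hs : (Set.range s).Finite) (l : ℝ) :
    (Set.range (l • s)).Finite := by
  refine (hs.image (l * ·)).subset ?_
  rintro _ ⟨ω, rfl⟩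
  exact ⟨_, ⟨ω, rfl⟩, rfl⟩

lemma simpleIntegral_const (hm : IsFinAddProb m) (c : ℝ) :
    simpleIntegral m (fun _ => c) = c := by
  rw [simpleIntegral_eq_sum m (F := {c}) (by rintro _ ⟨ω, rfl⟩; simp)]
  simp only [Finset.sum_singleton]
  rw [Set.preimage_const_of_mem (by simp), hm.2, mul_one]

/-- A linear functional that represents `m` on indicators represents the integral of simple
functions. -/
lemma simpleIntegral_eq_of_indicator (φ : (Ω → ℝ) →ₗ[ℝ] ℝ)
    (hφ : ∀ A : Set Ω, φ (A.indicator 1) = m A) {s : Ω → ℝ} (hs : (Set.range s).Finite) :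
    simpleIntegral m s = φ s := by
  have h : s = ∑ c ∈ hs.toFinset, c • (s ⁻¹' {c}).indicator 1 := by
    funext ω
    rw [Finset.sum_apply, Finset.sum_eq_single (s ω)]
    · simp
    · intro c _ hc
      simp [Set.indicator, hc.symm]
    · simp
  rw [simpleIntegral_eq_sum m (F := hs.toFinset) (by simp)]
  conv_rhs => rw [h, map_sum]
  exact Finset.sum_congr rfl fun c _ => by rw [map_smul, hφ, smul_eq_mul]

/-! ### The integral of nonnegative functions -/

/-- The integral of a nonnegative function. -/
noncomputable def lowerIntegral (m : AddContent ℝ (Set.univ : Set (Set Ω))) (f : Ω → ℝ) : ℝ :=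
  sSup (lowerSums m f)

lemma lowerSums_subset {f g : Ω → ℝ} (h : ∀ ω, f ω ≤ g ω) : lowerSums m f ⊆ lowerSums m g := by
  rintro r ⟨s, hs, hs0, hsf, rfl⟩
  exact ⟨s, hs, hs0, fun ω => (hsf ω).trans (h ω), rfl⟩

lemma zero_mem_lowerSums (hm : IsFinAddProb m) {f : Ω → ℝ} (hf : ∀ ω, 0 ≤ f ω) :
    0 ∈ lowerSums m f :=
  ⟨fun _ => 0, finite_range_const 0, fun _ => le_rfl, hf, (simpleIntegral_const hm 0).symm⟩

lemma simpleIntegral_le_lowerIntegral {f s : Ω → ℝ} (hf : BddAbove (lowerSums m f))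
    (hs : (Set.range s).Finite) (hs0 : ∀ ω, 0 ≤ s ω) (hsf : ∀ ω, s ω ≤ f ω) :
    simpleIntegral m s ≤ lowerIntegral m f :=
  le_csSup hf ⟨s, hs, hs0, hsf, rfl⟩

lemma lowerIntegral_le (hm : IsFinAddProb m) {f : Ω → ℝ} (hf : ∀ ω, 0 ≤ f ω) {C : ℝ}
    (h : ∀ s : Ω → ℝ, (Set.range s).Finite → (∀ ω, 0 ≤ s ω) → (∀ ω, s ω ≤ f ω) →
      simpleIntegral m s ≤ C) : lowerIntegral m f ≤ C := by
  refine csSup_le ⟨0, zero_mem_lowerSums hm hf⟩ ?_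
  rintro r ⟨s, hs, hs0, hsf, rfl⟩
  exact h s hs hs0 hsf

lemma lowerIntegral_nonneg (hm : IsFinAddProb m) {f : Ω → ℝ} (hf : ∀ ω, 0 ≤ f ω)
    (hfb : BddAbove (lowerSums m f)) : 0 ≤ lowerIntegral m f :=
  le_csSup hfb (zero_mem_lowerSums hm hf)

/-- Approximation of truncations by simple functions, uniformly from below. -/
lemma exists_simple_approx {f : Ω → ℝ} (hf : ∀ ω, 0 ≤ f ω) {n ε : ℝ} (hn : 0 ≤ n) (hε : 0 < ε) :
    ∃ s : Ω → ℝ, (Set.range s).Finite ∧ (∀ ω, 0 ≤ s ω) ∧ (∀ ω, s ω ≤ f ω) ∧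
      ∀ ω, min (f ω) n ≤ s ω + ε := by
  have h0 : ∀ ω, 0 ≤ min (f ω) n / ε := fun ω => div_nonneg (le_min (hf ω) hn) hε.le
  refine ⟨fun ω => ε * ⌊min (f ω) n / ε⌋₊, ?_, fun ω => by positivity, fun ω => ?_, fun ω => ?_⟩
  · refine ((Set.finite_Iic ⌊n / ε⌋₊).image fun k : ℕ => ε * (k : ℝ)).subset ?_
    rintro _ ⟨ω, rfl⟩
    refine ⟨_, ?_, rfl⟩
    exact Nat.floor_le_floor (by gcongr; exact min_le_right _ _)
  · refine le_trans ?_ (min_le_left (f ω) n)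
    have := mul_le_mul_of_nonneg_left (Nat.floor_le (h0 ω)) hε.le
    rwa [mul_div_cancel₀ _ hε.ne'] at this
  · have := mul_le_mul_of_nonneg_left (Nat.lt_floor_add_one (min (f ω) n / ε)).le hε.le
    rw [mul_div_cancel₀ _ hε.ne'] at this
    linarith

lemma exists_bound_of_finite_range {s : Ω → ℝ} (hs : (Set.range s).Finite) :
    ∃ n : ℝ, 0 ≤ n ∧ ∀ ω, s ω ≤ n := by
  obtain ⟨n, hn⟩ := hs.bddAbove
  exact ⟨max n 0, le_max_right _ _, fun ω => (hn ⟨ω, rfl⟩).trans (le_max_left _ _)⟩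

/-- If `n` bounds `s`, then `s ≤ min f n + min g n`: a summand cut at `n` already dominates `s`.
Both truncations are simple up to `ε / 2`. -/
lemma simpleIntegral_le_add (hm : IsFinAddProb m) {f g s : Ω → ℝ} (hf : ∀ ω, 0 ≤ f ω)
    (hg : ∀ ω, 0 ≤ g ω) (hfb : BddAbove (lowerSums m f)) (hgb : BddAbove (lowerSums m g))
    (hs : (Set.range s).Finite) (hsfg : ∀ ω, s ω ≤ f ω + g ω) :
    simpleIntegral m s ≤ lowerIntegral m f + lowerIntegral m g := by
  obtain ⟨n, hn, hsn⟩ := exists_bound_of_finite_range hs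
  refine le_of_forall_pos_le_add fun ε hε => ?_
  obtain ⟨u, hu, hu0, huf, hun⟩ := exists_simple_approx hf hn (half_pos hε)
  obtain ⟨v, hv, hv0, hvg, hvn⟩ := exists_simple_approx hg hn (half_pos hε)
  have huv := finite_range_add hu hv
  have h1 : simpleIntegral m s ≤ simpleIntegral m ((u + v) + fun _ => ε) := by
    refine simpleIntegral_mono hm hs (finite_range_add huv (finite_range_const ε)) fun ω => ?_
    have h1 := hun ω
    have h2 := hvn ω
    have h3 := hsn ω
    have h4 := hsfg ω
    simp only [Pi.add_apply]
    rcases min_choice (f ω) n with h | h <;> rcases min_choice (g ω) n with h' | h' <;>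
      rw [h] at h1 <;> rw [h'] at h2 <;> linarith [hu0 ω, hv0 ω]
  rw [simpleIntegral_add huv (finite_range_const ε), simpleIntegral_add hu hv,
    simpleIntegral_const hm] at h1
  linarith [simpleIntegral_le_lowerIntegral hfb hu hu0 huf,
    simpleIntegral_le_lowerIntegral hgb hv hv0 hvg]

lemma bddAbove_lowerSums_add (hm : IsFinAddProb m) {f g : Ω → ℝ} (hf : ∀ ω, 0 ≤ f ω)
    (hg : ∀ ω, 0 ≤ g ω) (hfb : BddAbove (lowerSums m f)) (hgb : BddAbove (lowerSums m g)) :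
    BddAbove (lowerSums m (f + g)) := by
  refine ⟨lowerIntegral m f + lowerIntegral m g, ?_⟩
  rintro r ⟨s, hs, -, hsf, rfl⟩
  exact simpleIntegral_le_add hm hf hg hfb hgb hs hsf

lemma lowerIntegral_add (hm : IsFinAddProb m) {f g : Ω → ℝ} (hf : ∀ ω, 0 ≤ f ω)
    (hg : ∀ ω, 0 ≤ g ω) (hfb : BddAbove (lowerSums m f)) (hgb : BddAbove (lowerSums m g)) :
    lowerIntegral m (f + g) = lowerIntegral m f + lowerIntegral m g := by
  refine le_antisymm ?_ ?_
  · exact lowerIntegral_le hm (fun ω => add_nonneg (hf ω) (hg ω)) fun s hs _ hsf =>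
      simpleIntegral_le_add hm hf hg hfb hgb hs hsf
  · rw [← le_sub_iff_add_le]
    refine lowerIntegral_le hm hf fun s hs hs0 hsf => ?_
    rw [le_sub_comm]
    refine lowerIntegral_le hm hg fun t ht ht0 htg => ?_
    rw [le_sub_iff_add_le, add_comm, ← simpleIntegral_add hs ht]
    exact simpleIntegral_le_lowerIntegral (bddAbove_lowerSums_add hm hf hg hfb hgb)
      (finite_range_add hs ht) (fun ω => add_nonneg (hs0 ω) (ht0 ω))
      fun ω => add_le_add (hsf ω) (htg ω)

lemma lowerIntegral_zero (hm : IsFinAddProb m) : lowerIntegral m (fun _ => 0) = 0 := by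
  have hb : BddAbove (lowerSums m fun _ => 0) := by
    refine ⟨0, ?_⟩
    rintro r ⟨s, hs, -, hsf, rfl⟩
    exact (simpleIntegral_mono hm hs (finite_range_const 0) hsf).trans_eq
      (simpleIntegral_const hm 0)
  refine le_antisymm (csSup_le ⟨0, zero_mem_lowerSums hm fun _ => le_rfl⟩ ?_)
    (lowerIntegral_nonneg hm (fun _ => le_rfl) hb)
  rintro r ⟨s, hs, -, hsf, rfl⟩
  exact (simpleIntegral_mono hm hs (finite_range_const 0) hsf).trans_eq (simpleIntegral_const hm 0)

lemma smul_mem_lowerSums {f : Ω → ℝ} {l r : ℝ} (hl : 0 ≤ l) (h : r ∈ lowerSums m f) :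
    l * r ∈ lowerSums m (l • f) := by
  obtain ⟨s, hs, hs0, hsf, rfl⟩ := h
  exact ⟨l • s, finite_range_smul hs l, fun ω => mul_nonneg hl (hs0 ω),
    fun ω => mul_le_mul_of_nonneg_left (hsf ω) hl, (simpleIntegral_smul hs l).symm⟩

open scoped Pointwise in
lemma lowerSums_smul {f : Ω → ℝ} {l : ℝ} (hl : 0 < l) :
    lowerSums m (l • f) = l • lowerSums m f := by
  ext r
  rw [Set.mem_smul_set]
  constructor
  · intro h
    refine ⟨l⁻¹ * r, ?_, by simp [hl.ne']⟩
    simpa [smul_smul, hl.ne'] using smul_mem_lowerSums (inv_nonneg.2 hl.le) h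
  · rintro ⟨r, hr, rfl⟩
    exact smul_mem_lowerSums hl.le hr

lemma lowerIntegral_smul (hm : IsFinAddProb m) {f : Ω → ℝ} {l : ℝ} (hl : 0 ≤ l) :
    lowerIntegral m (l • f) = l * lowerIntegral m f := by
  rcases hl.eq_or_lt with rfl | hl
  · rw [zero_smul, zero_mul]
    exact lowerIntegral_zero hm
  · rw [lowerIntegral, lowerSums_smul hl, Real.sSup_smul_of_nonneg hl.le]
    rfl

/-! ### The integral of integrable functions -/

lemma IntegrableFA.of_abs_le {f g : Ω → ℝ} (hg : IntegrableFA m g) (h : ∀ ω, |f ω| ≤ |g ω|) :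
    IntegrableFA m f :=
  BddAbove.mono (lowerSums_subset h) hg

lemma IntegrableFA.bddAbove {f g : Ω → ℝ} (hg : IntegrableFA m g) (h : ∀ ω, f ω ≤ |g ω|) :
    BddAbove (lowerSums m f) :=
  BddAbove.mono (lowerSums_subset h) hg

lemma IntegrableFA.add (hm : IsFinAddProb m) {f g : Ω → ℝ} (hf : IntegrableFA m f)
    (hg : IntegrableFA m g) : IntegrableFA m (f + g) :=
  BddAbove.mono (lowerSums_subset fun ω => abs_add_le (f ω) (g ω))
    (bddAbove_lowerSums_add hm (fun ω => abs_nonneg (f ω)) (fun ω => abs_nonneg (g ω)) hf hg)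

lemma IntegrableFA.neg {f : Ω → ℝ} (hf : IntegrableFA m f) : IntegrableFA m (-f) :=
  hf.of_abs_le fun ω => by simp

lemma IntegrableFA.bddAbove_pos {f : Ω → ℝ} (hf : IntegrableFA m f) :
    BddAbove (lowerSums m fun ω => max (f ω) 0) :=
  hf.bddAbove fun _ => max_le (le_abs_self _) (abs_nonneg _)

lemma IntegrableFA.bddAbove_neg {f : Ω → ℝ} (hf : IntegrableFA m f) :
    BddAbove (lowerSums m fun ω => max (-f ω) 0) :=
  hf.bddAbove fun _ => max_le (neg_le_abs _) (abs_nonneg _)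

lemma max_zero_sub_max_neg_zero (x : ℝ) : max x 0 - max (-x) 0 = x := by
  rcases le_total 0 x with h | h <;> simp [h]

/-- The difference does not depend on the decomposition: `f⁺ + b = a + f⁻`, and the integral is
additive on nonnegative functions. -/
lemma integralFA_eq_sub (hm : IsFinAddProb m) {f a b : Ω → ℝ} (hf : IntegrableFA m f)
    (ha : ∀ ω, 0 ≤ a ω) (hb : ∀ ω, 0 ≤ b ω) (hab : BddAbove (lowerSums m a))
    (hbb : BddAbove (lowerSums m b)) (h : ∀ ω, f ω = a ω - b ω) :
    integralFA m f = lowerIntegral m a - lowerIntegral m b := by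
  have h1 := lowerIntegral_add hm (fun ω => le_max_right (f ω) 0) hb hf.bddAbove_pos hbb
  have h2 := lowerIntegral_add hm ha (fun ω => le_max_right (-f ω) 0) hab hf.bddAbove_neg
  have h3 : (fun ω => max (f ω) 0) + b = a + fun ω => max (-f ω) 0 := by
    funext ω
    have := max_zero_sub_max_neg_zero (f ω)
    simp only [Pi.add_apply]
    linarith [h ω]
  rw [h3, h2] at h1
  change lowerIntegral m _ - lowerIntegral m _ = _
  linarith

lemma integralFA_eq_lowerIntegral (hm : IsFinAddProb m) {f : Ω → ℝ} (hf : ∀ ω, 0 ≤ f ω) :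
    integralFA m f = lowerIntegral m f := by
  have h1 : (fun ω => max (f ω) 0) = f := funext fun ω => max_eq_left (hf ω)
  have h2 : (fun ω => max (-f ω) 0) = fun _ => 0 :=
    funext fun ω => max_eq_right (neg_nonpos.2 (hf ω))
  change lowerIntegral m _ - lowerIntegral m _ = _
  rw [h1, h2, lowerIntegral_zero hm, sub_zero]

lemma integralFA_add (hm : IsFinAddProb m) {f g : Ω → ℝ} (hf : IntegrableFA m f)
    (hg : IntegrableFA m g) : integralFA m (f + g) = integralFA m f + integralFA m g := by
  have hp : ∀ (h : Ω → ℝ) ω, 0 ≤ max (h ω) 0 := fun h ω => le_max_right _ _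
  have hn : ∀ (h : Ω → ℝ) ω, 0 ≤ max (-h ω) 0 := fun h ω => le_max_right _ _
  rw [integralFA_eq_sub hm (hf.add hm hg) (fun ω => add_nonneg (hp f ω) (hp g ω))
      (fun ω => add_nonneg (hn f ω) (hn g ω))
      (bddAbove_lowerSums_add hm (hp f) (hp g) hf.bddAbove_pos hg.bddAbove_pos)
      (bddAbove_lowerSums_add hm (hn f) (hn g) hf.bddAbove_neg hg.bddAbove_neg) fun ω => by
        have h1 := max_zero_sub_max_neg_zero (f ω)
        have h2 := max_zero_sub_max_neg_zero (g ω)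
        simp only [Pi.add_apply]
        linarith]
  have h1 := lowerIntegral_add hm (hp f) (hp g) hf.bddAbove_pos hg.bddAbove_pos
  have h2 := lowerIntegral_add hm (hn f) (hn g) hf.bddAbove_neg hg.bddAbove_neg
  have h3 : integralFA m f
      = lowerIntegral m (fun ω => max (f ω) 0) - lowerIntegral m (fun ω => max (-f ω) 0) := rfl
  have h4 : integralFA m g
      = lowerIntegral m (fun ω => max (g ω) 0) - lowerIntegral m (fun ω => max (-g ω) 0) := rfl
  rw [h3, h4]
  change lowerIntegral m ((fun ω => max (f ω) 0) + fun ω => max (g ω) 0)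
    - lowerIntegral m ((fun ω => max (-f ω) 0) + fun ω => max (-g ω) 0) = _
  linarith

lemma integralFA_neg (f : Ω → ℝ) : integralFA m (-f) = -integralFA m f := by
  simp [integralFA]

lemma integralFA_smul (hm : IsFinAddProb m) (f : Ω → ℝ) {l : ℝ} (hl : 0 ≤ l) :
    integralFA m (l • f) = l * integralFA m f := by
  have h1 : (fun ω => max ((l • f) ω) 0) = l • fun ω => max (f ω) 0 := by
    funext ω
    simp [mul_max_of_nonneg _ _ hl]
  have h2 : (fun ω => max (-(l • f) ω) 0) = l • fun ω => max (-f ω) 0 := by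
    funext ω
    simp [mul_max_of_nonneg _ _ hl]
  change lowerIntegral m _ - lowerIntegral m _ = l * (lowerIntegral m _ - lowerIntegral m _)
  rw [h1, h2, lowerIntegral_smul hm hl, lowerIntegral_smul hm hl, mul_sub]

lemma integrableFA_const (hm : IsFinAddProb m) (c : ℝ) : IntegrableFA m fun _ => c := by
  refine ⟨|c|, ?_⟩
  rintro r ⟨s, hs, -, hsf, rfl⟩
  exact (simpleIntegral_mono hm hs (finite_range_const |c|) hsf).trans_eq
    (simpleIntegral_const hm _)

lemma integralFA_one (hm : IsFinAddProb m) : integralFA m 1 = 1 := by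
  rw [integralFA_eq_lowerIntegral (f := 1) hm fun _ => zero_le_one]
  refine le_antisymm ?_ ?_
  · refine lowerIntegral_le hm (fun _ => zero_le_one) fun s hs _ hsf => ?_
    exact (simpleIntegral_mono hm hs (finite_range_const 1) hsf).trans_eq
      (simpleIntegral_const hm _)
  · have hb : BddAbove (lowerSums m (1 : Ω → ℝ)) :=
      (integrableFA_const hm 1).bddAbove fun ω => by simp
    have := simpleIntegral_le_lowerIntegral hb (finite_range_const 1) (fun _ => zero_le_one)
      fun _ => le_rfl
    rwa [simpleIntegral_const hm] at this

lemma integralFA_const (hm : IsFinAddProb m) (c : ℝ) : integralFA m (fun _ => c) = c := by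
  rcases le_total 0 c with hc | hc
  · have := integralFA_smul hm 1 hc
    rw [integralFA_one hm, mul_one] at this
    convert this using 2
    funext; simp
  · have := integralFA_smul hm 1 (neg_nonneg.2 hc)
    rw [integralFA_one hm, mul_one] at this
    rw [← neg_inj, ← integralFA_neg]
    convert this using 2
    funext; simp

lemma integralFA_sum (hm : IsFinAddProb m) {ι : Type*} (F : Finset ι) {f : ι → Ω → ℝ}
    (hf : ∀ i ∈ F, IntegrableFA m (f i)) :
    IntegrableFA m (∑ i ∈ F, f i) ∧ integralFA m (∑ i ∈ F, f i) = ∑ i ∈ F, integralFA m (f i) := by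
  classical
  induction F using Finset.induction_on with
  | empty => exact ⟨integrableFA_const hm 0, integralFA_const hm 0⟩
  | insert a F ha ih =>
    obtain ⟨h1, h2⟩ := ih fun i hi => hf i (Finset.mem_insert_of_mem hi)
    have h3 := hf a (Finset.mem_insert_self _ _)
    rw [Finset.sum_insert ha, Finset.sum_insert ha]
    exact ⟨h3.add hm h1, by rw [integralFA_add hm h3 h1, h2]⟩

end Integral

section Order

variable {ge : (Ω → ℝ) → (Ω → ℝ) → Prop} {X : Set (Ω → ℝ)} {p : (Ω → ℝ) → ℝ}

/-! ### Elementary properties of a common order -/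

lemma IsCommonOrder.add_right (hge : IsCommonOrder ge) {f g : Ω → ℝ} (h : ge f g) (k : Ω → ℝ) :
    ge (f + k) (g + k) := by
  simpa using hge.affine f g h 1 (fun _ => zero_le_one) ⟨1, fun _ => le_rfl⟩ k

lemma IsCommonOrder.smul (hge : IsCommonOrder ge) {f g : Ω → ℝ} (h : ge f g) {l : ℝ}
    (hl : 0 ≤ l) : ge (l • f) (l • g) := by
  have := hge.affine f g h (fun _ => l) (fun _ => hl) ⟨l, fun _ => le_rfl⟩ 0
  rw [add_zero, add_zero] at this
  exact this

lemma IsCommonOrder.add (hge : IsCommonOrder ge) {f g f' g' : Ω → ℝ} (h : ge f g)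
    (h' : ge f' g') : ge (f + f') (g + g') := by
  refine hge.trans _ (g + f') _ (hge.add_right h f') ?_
  rw [add_comm g, add_comm g]
  exact hge.add_right h' g

lemma IsCommonOrder.sub_nonneg (hge : IsCommonOrder ge) {f g : Ω → ℝ} (h : ge f g) :
    ge (f - g) 0 := by
  simpa [sub_eq_add_neg] using hge.add_right h (-g)

lemma IsCommonOrder.sum_nonneg (hge : IsCommonOrder ge) {ι : Type*} (F : Finset ι)
    {f : ι → Ω → ℝ} (hf : ∀ i ∈ F, ge (f i) 0) : ge (∑ i ∈ F, f i) 0 := by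
  classical
  induction F using Finset.induction_on with
  | empty => exact hge.refl _
  | insert a F ha ih =>
    rw [Finset.sum_insert ha, ← add_zero (0 : Ω → ℝ)]
    exact hge.add (hf a (Finset.mem_insert_self _ _))
      (ih fun i hi => hf i (Finset.mem_insert_of_mem hi))

/-- Multiply `h ≥_* 0` by the indicator of `{h < 0}` and add the negative part; this is where a
non-constant multiplier is needed. -/
lemma IsCommonOrder.neg_part (hge : IsCommonOrder ge) {h : Ω → ℝ} (hh : ge h 0) :
    ge 0 (fun ω => max (-h ω) 0) := by
  classical
  have h1 := hge.affine h 0 hh (fun ω => if h ω < 0 then 1 else 0)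
    (fun ω => by split_ifs <;> simp) ⟨1, fun ω => by split_ifs <;> simp⟩
    (fun ω => max (-h ω) 0)
  convert h1 using 1
  · funext ω
    by_cases hω : h ω < 0
    · simp [hω, hω.le]
    · simp [hω, not_lt.1 hω]
  · simp

/-! ### Superhedgeable claims -/

lemma superhedgeable_of_ge (hge : IsCommonOrder ge) {f g : Ω → ℝ} (hg : g ∈ superhedgeable ge X)
    (h : ge (fun ω => |g ω|) (fun ω => |f ω|)) : f ∈ superhedgeable ge X := by
  obtain ⟨l, hl, k, hk, hkg⟩ := hg
  exact ⟨l, hl, k, hk, hge.trans _ _ _ hkg h⟩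

lemma superhedgeable_of_abs_le (hge : IsCommonOrder ge) {f g : Ω → ℝ}
    (hg : g ∈ superhedgeable ge X) (h : ∀ ω, |f ω| ≤ |g ω|) : f ∈ superhedgeable ge X :=
  superhedgeable_of_ge hge hg (hge.mono _ _ h)

/-- The superhedgeable claims form a vector space. -/
def superhedgeableSubmodule (hge : IsCommonOrder ge) (hX : IsAssetSet ge X) :
    Submodule ℝ (Ω → ℝ) where
  carrier := superhedgeable ge X
  zero_mem' := ⟨1, one_pos, 0, hX.zero_mem, hge.mono _ _ fun ω => by simp⟩
  add_mem' := by
    rintro f g ⟨l, hl, u, hu, huf⟩ ⟨k, hk, v, hv, hvg⟩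
    refine ⟨l + k, add_pos hl hk, (l / (l + k)) • u + (k / (l + k)) • v,
      hX.convex hu hv (by positivity) (by positivity) (by field_simp), ?_⟩
    have h1 : (l + k) • ((l / (l + k)) • u + (k / (l + k)) • v) = l • u + k • v := by
      rw [smul_add, smul_smul, smul_smul, mul_div_cancel₀ _ (add_pos hl hk).ne',
        mul_div_cancel₀ _ (add_pos hl hk).ne']
    rw [h1]
    exact hge.trans _ _ _ (hge.add huf hvg) (hge.mono _ _ fun ω => abs_add_le _ _)
  smul_mem' := by
    rintro c f ⟨l, hl, u, hu, huf⟩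
    refine ⟨(|c| + 1) * l, by positivity, u, hu, ?_⟩
    rw [← smul_smul]
    refine hge.trans _ _ _ (hge.smul huf (by positivity)) (hge.mono _ _ fun ω => ?_)
    simp only [Pi.smul_apply, smul_eq_mul, abs_mul]
    nlinarith [abs_nonneg (f ω)]

lemma const_mem_superhedgeable (hge : IsCommonOrder ge) (hX : IsAssetSet ge X) (c : ℝ) :
    (fun _ => c) ∈ superhedgeable ge X :=
  ⟨|c| + 1, by positivity, 1, hX.one_mem, hge.mono _ _ fun ω => by simp⟩

lemma superhedgeable_of_bounded (hge : IsCommonOrder ge) (hX : IsAssetSet ge X) {f : Ω → ℝ}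
    {c : ℝ} (h : ∀ ω, |f ω| ≤ c) : f ∈ superhedgeable ge X :=
  superhedgeable_of_abs_le hge (const_mem_superhedgeable hge hX c) fun ω =>
    (h ω).trans (le_abs_self c)

lemma subset_superhedgeable (hge : IsCommonOrder ge) (hX : IsAssetSet ge X) :
    X ⊆ superhedgeable ge X := by
  intro f hf
  obtain ⟨a, ha⟩ := hX.bounded_below f hf
  refine ⟨1, one_pos, _, hX.add_const_mem f hf (2 * |a|) (by positivity), ?_⟩
  -- The negative part of `f - a` is null for the order, and pointwise `|f| ≤ f + 2|a| + 2 (f -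
  -- a)⁻`.
  have h1 := hge.add_right (hge.smul (hge.neg_part (hge.sub_nonneg ha)) zero_le_two)
    (fun ω => f ω + 2 * |a|)
  rw [smul_zero, zero_add] at h1
  rw [one_smul]
  refine hge.trans _ _ _ h1 (hge.mono _ _ fun ω => ?_)
  simp only [Pi.add_apply, Pi.smul_apply, Pi.sub_apply, smul_eq_mul]
  have h2 := le_max_left (-(f ω - a)) 0
  have h3 := le_max_right (-(f ω - a)) 0
  have h4 := neg_abs_le a
  have h5 := abs_nonneg a
  exact abs_le.2 ⟨by linarith, by linarith⟩

lemma callOverwriting_subset (hge : IsCommonOrder ge) (hX : IsAssetSet ge X) :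
    callOverwriting X ⊆ superhedgeable ge X := by
  rintro f (hf | ⟨g, hg, k, hk, rfl⟩)
  · exact subset_superhedgeable hge hX hf
  · refine superhedgeable_of_abs_le hge (subset_superhedgeable hge hX hg) fun ω => ?_
    rcases le_total (g ω) k with h | h
    · simp [h]
    · simp only [min_eq_right h, abs_of_nonneg hk]
      exact h.trans (le_abs_self _)

lemma convexHull_callOverwriting_subset (hge : IsCommonOrder ge) (hX : IsAssetSet ge X) :
    convexHull ℝ (callOverwriting X) ⊆ superhedgeable ge X :=
  convexHull_min (callOverwriting_subset hge hX) (superhedgeableSubmodule hge hX).convex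

lemma inf_one_mem_callOverwriting {f : Ω → ℝ} (hf : f ∈ callOverwriting X) :
    f ⊓ 1 ∈ callOverwriting X := by
  rcases hf with hf | ⟨g, hg, k, hk, rfl⟩
  · exact Or.inr ⟨f, hf, 1, zero_le_one, rfl⟩
  · exact Or.inr ⟨g, hg, min k 1, le_min hk zero_le_one, funext fun ω => min_assoc _ _ _⟩

lemma add_const_mem_callOverwriting (hX : IsAssetSet ge X) {f : Ω → ℝ}
    (hf : f ∈ callOverwriting X) {a : ℝ} (ha : 0 ≤ a) :
    (fun ω => f ω + a) ∈ callOverwriting X := by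
  rcases hf with hf | ⟨g, hg, k, hk, rfl⟩
  · exact Or.inl (hX.add_const_mem f hf a ha)
  · exact Or.inr ⟨_, hX.add_const_mem g hg a ha, k + a, add_nonneg hk ha,
      funext fun ω => (min_add_add_right _ _ _).symm⟩

lemma smul_mem_callOverwriting (hX : IsAssetSet ge X) {f : Ω → ℝ}
    (hf : f ∈ callOverwriting X) {l : ℝ} (hl0 : 0 ≤ l) (hl1 : l ≤ 1) :
    l • f ∈ callOverwriting X := by
  have hX' : ∀ g ∈ X, l • g ∈ X := fun g hg =>
    hX.convex.smul_mem_of_zero_mem hX.zero_mem hg ⟨hl0, hl1⟩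
  rcases hf with hf | ⟨g, hg, k, hk, rfl⟩
  · exact Or.inl (hX' f hf)
  · exact Or.inr ⟨_, hX' g hg, l * k, mul_nonneg hl0 hk,
      funext fun ω => mul_min_of_nonneg _ _ hl0⟩

lemma add_const_mem_convexHull (hX : IsAssetSet ge X) {f : Ω → ℝ}
    (hf : f ∈ convexHull ℝ (callOverwriting X)) {a : ℝ} (ha : 0 ≤ a) :
    (fun ω => f ω + a) ∈ convexHull ℝ (callOverwriting X) := by
  have h : convexHull ℝ (callOverwriting X) ⊆
      (fun g : Ω → ℝ => g + fun _ => a) ⁻¹' convexHull ℝ (callOverwriting X) := by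
    refine convexHull_min (fun g hg => subset_convexHull ℝ _
      (add_const_mem_callOverwriting hX hg ha)) ?_
    exact (convex_convexHull ℝ _).translate_preimage_left _
  exact h hf

/-! ### Integrals and the order -/

variable {m : AddContent ℝ (Set.univ : Set (Set Ω))}

/-- Each level set of `s` at a value `c > 0` is negligible, since its indicator is at most `c⁻¹ •
s`. -/
lemma simpleIntegral_eq_zero_of_ge (hge : IsCommonOrder ge)
    (hn : ∀ A ∈ negligible ge, m A = 0) {s : Ω → ℝ} (hs : (Set.range s).Finite)
    (hs0 : ∀ ω, 0 ≤ s ω) (hz : ge 0 s) : simpleIntegral m s = 0 := by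
  rw [simpleIntegral_eq_sum m (F := hs.toFinset) (by simp)]
  refine Finset.sum_eq_zero fun c hc => ?_
  obtain ⟨ω, rfl⟩ := hs.mem_toFinset.1 hc
  rcases (hs0 ω).eq_or_lt with h | h
  · rw [← h, zero_mul]
  · rw [hn, mul_zero]
    have h1 := hge.smul hz (inv_nonneg.2 h.le)
    rw [smul_zero] at h1
    refine hge.trans _ _ _ h1 (hge.mono _ _ fun ω' => ?_)
    by_cases hω : s ω' = s ω
    · simp [Set.indicator, hω, h.ne']
    · simpa [Set.indicator, hω] using mul_nonneg (inv_nonneg.2 h.le) (hs0 ω')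

lemma lowerIntegral_eq_zero_of_ge (hge : IsCommonOrder ge) (hm : IsFinAddProb m)
    (hn : ∀ A ∈ negligible ge, m A = 0) {h : Ω → ℝ} (h0 : ∀ ω, 0 ≤ h ω) (hz : ge 0 h) :
    lowerIntegral m h = 0 := by
  have : lowerSums m h = {0} := by
    refine Set.Subset.antisymm ?_ (by simpa using zero_mem_lowerSums hm h0)
    rintro r ⟨s, hs, hs0, hsh, rfl⟩
    exact simpleIntegral_eq_zero_of_ge hge hn hs hs0 (hge.trans _ _ _ hz (hge.mono _ _ hsh))
  rw [lowerIntegral, this, csSup_singleton]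

lemma integralFA_mono_of_ge (hge : IsCommonOrder ge) (hm : IsFinAddProb m)
    (hn : ∀ A ∈ negligible ge, m A = 0) {f g : Ω → ℝ} (hf : IntegrableFA m f)
    (hg : IntegrableFA m g) (h : ge f g) : integralFA m g ≤ integralFA m f := by
  have hi := hf.add hm hg.neg
  have h1 := integralFA_add hm hg hi
  have h2 : g + (f + -g) = f := by simp
  rw [h2] at h1
  have h3 : integralFA m (f + -g) = lowerIntegral m (fun ω => max ((f + -g) ω) 0)
      - lowerIntegral m (fun ω => max (-(f + -g) ω) 0) := rfl
  rw [lowerIntegral_eq_zero_of_ge hge hm hn (fun ω => le_max_right _ _)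
    (hge.neg_part (by simpa [sub_eq_add_neg] using hge.sub_nonneg h))] at h3
  have h4 := lowerIntegral_nonneg hm (fun ω => le_max_right ((f + -g) ω) 0) hi.bddAbove_pos
  linarith

/-! ### The functional of a pricing measure -/

lemma exists_functional_of_strictPricingMeasures (hge : IsCommonOrder ge) (hX : IsAssetSet ge X)
    (h : (strictPricingMeasures ge X p (callOverwriting X)).Nonempty) :
    ∃ r : (Ω → ℝ) → ℝ,
      IsPricing ge (convexHull ℝ (callOverwriting X)) r ∧
      NoArbitrage ge (callOverwriting X) r ∧
      CashAdditive (convexHull ℝ (callOverwriting X)) r ∧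
      (∀ f ∈ X, r f ≤ p f) ∧
      marketPower ge (convexHull ℝ (callOverwriting X)) (callOverwriting X) r < 1 := by
  obtain ⟨m, ⟨hm, hn, hL, hp⟩, hpos⟩ := h
  have hI : ∀ f ∈ convexHull ℝ (callOverwriting X), IntegrableFA m f := fun f hf =>
    hL f (convexHull_callOverwriting_subset hge hX hf)
  have hI' : ∀ f ∈ callOverwriting X, IntegrableFA m f := fun f hf =>
    hI f (subset_convexHull ℝ _ hf)
  refine ⟨integralFA m, ⟨integralFA_one hm, fun f _ l hl _ => integralFA_smul hm f hl,
    fun f hf g hg _ => (integralFA_add hm (hI f hf) (hI g hg)).le,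
    fun f hf g hg hfg => integralFA_mono_of_ge hge hm hn (hI f hf) (hI g hg) hfg⟩,
    fun f hf hf0 => ?_, fun f hf a _ => ?_, hp, ?_⟩
  · exact (hpos f hf hf0).trans_le (integralFA_mono_of_ge hge hm hn (hI' f hf)
      (hI' _ (inf_one_mem_callOverwriting hf)) (hge.mono _ _ fun ω => min_le_left _ _))
  · exact (integralFA_add hm (hI f hf) (integrableFA_const hm a)).trans
      (by rw [integralFA_const hm])
  -- Additivity of the integral makes every ratio in the supremum vanish.
  · refine lt_of_le_of_lt (Real.sSup_le ?_ le_rfl) one_pos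
    rintro x ⟨N, f, hf, -, rfl⟩
    rw [(integralFA_sum hm Finset.univ fun i _ => hI' _ (hf i).1).2, sub_self, zero_div]

end Order

/-! ### A sandwich theorem -/

/-- A linear functional dominated by the constraints of a convex cone in `V × ℝ`. -/
theorem exists_linearMap_le_of_cone {V : Type*} [AddCommGroup V] [Module ℝ V] (W : Submodule ℝ V)
    (S : Set (V × ℝ)) (hzero : (0, 0) ∈ S) (hadd : ∀ y ∈ S, ∀ z ∈ S, y + z ∈ S)
    (hsmul : ∀ z ∈ S, ∀ l : ℝ, 0 < l → l • z ∈ S) (hS : ∀ t, ((0 : V), t) ∈ S → 0 ≤ t)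
    (hW : ∀ x ∈ W, ∃ t, (x, t) ∈ S) :
    ∃ φ : V →ₗ[ℝ] ℝ, ∀ x ∈ W, ∀ t, (x, t) ∈ S → φ x ≤ t := by
  let C : PointedCone ℝ (W × ℝ) :=
    { carrier := {z | ((z.1 : V), z.2) ∈ S}
      zero_mem' := hzero
      add_mem' := fun {y z} hy hz => hadd _ hy _ hz
      smul_mem' := by
        rintro ⟨l, hl⟩ z hz
        rcases hl.eq_or_lt with rfl | hl'
        · simpa using hzero
        · exact hsmul _ hz l hl' }
  -- The functional `(0, t) ↦ t` is nonnegative on the cone by `hS`, and `hW` gives the cofinality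
  -- needed to extend it to a positive `g`; then `φ x = -g (x, 0)`.
  let f : (W × ℝ) →ₗ.[ℝ] ℝ :=
    { domain := (⊥ : Submodule ℝ W).prod ⊤
      toFun := (LinearMap.snd ℝ W ℝ).comp (Submodule.subtype _) }
  obtain ⟨g, hgf, hgC⟩ := riesz_extension C f
    (by
      intro z hz
      have hx : z.1.1 = 0 := z.2.1
      have hz' : ((z.1.1 : V), z.1.2) ∈ S := hz
      rw [hx] at hz'
      exact hS _ hz')
    (by
      rintro ⟨x, t⟩
      obtain ⟨u, hu⟩ := hW x x.2
      refine ⟨⟨(0, u - t), ⟨rfl, trivial⟩⟩, ?_⟩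
      change (((0 + x : W) : V), u - t + t) ∈ S
      simpa using hu)
  obtain ⟨φ, hφ⟩ := LinearMap.exists_extend (-(g.comp (LinearMap.inl ℝ W ℝ)))
  refine ⟨φ, fun x hx t hxt => ?_⟩
  have h1 : φ x = -g (⟨x, hx⟩, 0) := LinearMap.congr_fun hφ ⟨x, hx⟩
  have h2 : g (0, t) = t := hgf ⟨(0, t), ⟨rfl, trivial⟩⟩
  have h3 : 0 ≤ g (⟨x, hx⟩, t) := hgC (⟨x, hx⟩, t) hxt
  have h4 : ((⟨x, hx⟩, t) : W × ℝ) = (⟨x, hx⟩, 0) + (0, t) := by simp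
  rw [h4, map_add, h2] at h3
  linarith

/-! ### ### The sandwich applied to a pricing functional -/

variable {ge : (Ω → ℝ) → (Ω → ℝ) → Prop} {X D B : Set (Ω → ℝ)}
  {p r : (Ω → ℝ) → ℝ} {c : ℝ}

/-- The positive combinations of elements of `B`, paired with the same combinations of their
prices. -/
def combinations (B : Set (Ω → ℝ)) (r : (Ω → ℝ) → ℝ) : Set ((Ω → ℝ) × ℝ) :=
  {z | ∃ (N : ℕ) (f : Fin N → Ω → ℝ) (w : Fin N → ℝ), (∀ i, f i ∈ B) ∧ (∀ i, 0 ≤ w i) ∧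
    z = (∑ i, w i • f i, ∑ i, w i * r (f i))}

lemma zero_mem_combinations : (0, 0) ∈ combinations B r :=
  ⟨0, Fin.elim0, Fin.elim0, fun i => i.elim0, fun i => i.elim0, by simp⟩

lemma mem_combinations {f : Ω → ℝ} (hf : f ∈ B) : (f, r f) ∈ combinations B r :=
  ⟨1, fun _ => f, fun _ => 1, fun _ => hf, fun _ => zero_le_one, by simp⟩

lemma add_mem_combinations {y z : (Ω → ℝ) × ℝ} (hy : y ∈ combinations B r)
    (hz : z ∈ combinations B r) : y + z ∈ combinations B r := by
  obtain ⟨N, f, w, hf, hw, rfl⟩ := hy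
  obtain ⟨M, g, v, hg, hv, rfl⟩ := hz
  refine ⟨N + M, Fin.append f g, Fin.append w v, fun i => ?_, fun i => ?_, ?_⟩
  · refine Fin.addCases (fun i => ?_) (fun i => ?_) i <;> simp [hf, hg]
  · refine Fin.addCases (fun i => ?_) (fun i => ?_) i <;> simp [hw, hv]
  · simp [Fin.sum_univ_add]

lemma smul_mem_combinations {z : (Ω → ℝ) × ℝ} (hz : z ∈ combinations B r) {l : ℝ}
    (hl : 0 ≤ l) : l • z ∈ combinations B r := by
  obtain ⟨N, f, w, hf, hw, rfl⟩ := hz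
  refine ⟨N, f, l • w, hf, fun i => mul_nonneg hl (hw i), ?_⟩
  simp [Finset.smul_sum, Finset.mul_sum, smul_smul, mul_assoc]

/-- The constraints `(x, t)` which say that the price of `x` is at most `t`: up to a positive
combination of elements of `B`, valued at `c` times their prices, `x` is superhedged by a
positive multiple of an element of `D` and cash. -/
def constraints (ge : (Ω → ℝ) → (Ω → ℝ) → Prop) (D B : Set (Ω → ℝ)) (r : (Ω → ℝ) → ℝ) (c : ℝ) :
    Set ((Ω → ℝ) × ℝ) :=
  {z | ∃ d ∈ D, ∃ l : ℝ, 0 < l ∧ ∃ a : ℝ, ∃ y ∈ combinations B r,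
    ge ((l • d) + fun _ => a) (z.1 + y.1) ∧ l * r d + a - c * y.2 ≤ z.2}

lemma IsPricing.map_zero (hr : IsPricing ge D r) (h0 : (0 : Ω → ℝ) ∈ D) : r 0 = 0 := by
  have := hr.pos_hom 0 h0 0 le_rfl (by simpa using h0)
  simpa using this

/-- This is the consistency of the constraints, and the place where the market power bound `hc`
enters. As `D` and `B` need not be cones, everything is first divided by a large `T`. -/
lemma combinations_le (hge : IsCommonOrder ge) (hD : Convex ℝ D) (h0 : (0 : Ω → ℝ) ∈ D)
    (hDa : ∀ f ∈ D, ∀ a : ℝ, 0 ≤ a → (fun ω => f ω + a) ∈ D) (hr : IsPricing ge D r)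
    (hca : CashAdditive D r) (hBD : B ⊆ D)
    (hBs : ∀ f ∈ B, ∀ l : ℝ, 0 ≤ l → l ≤ 1 → l • f ∈ B)
    (hc : ∀ (N : ℕ) (f : Fin N → Ω → ℝ), (∀ i, f i ∈ B) → ∑ i, f i ∈ D →
      c * ∑ i, r (f i) ≤ r (∑ i, f i))
    {y : (Ω → ℝ) × ℝ} (hy : y ∈ combinations B r) {d : Ω → ℝ} (hd : d ∈ D) {l a : ℝ} (hl : 0 < l)
    (h : ge ((l • d) + fun _ => a) y.1) : c * y.2 ≤ l * r d + a := by
  obtain ⟨N, f, w, hf, hw, rfl⟩ := hy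
  obtain ⟨T, hT, hTl, hTw⟩ : ∃ T : ℝ, 0 < T ∧ l ≤ T ∧ ∑ i, w i ≤ T :=
    ⟨l + ∑ i, w i, add_pos_of_pos_of_nonneg hl (Finset.sum_nonneg fun i _ => hw i),
      by linarith [Finset.sum_nonneg fun i (_ : i ∈ Finset.univ) => hw i], by linarith⟩
  have hw0 : ∀ i, 0 ≤ w i / T := fun i => div_nonneg (hw i) hT.le
  have hw1 : ∀ i, w i / T ≤ 1 := fun i => (div_le_one hT).2
    ((Finset.single_le_sum (fun i _ => hw i) (Finset.mem_univ i)).trans hTw)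
  have hfB : ∀ i, (w i / T) • f i ∈ B := fun i => hBs _ (hf i) _ (hw0 i) (hw1 i)
  have hsumD : ∑ i, (w i / T) • f i ∈ D := by
    -- The weights sum to at most one; the missing mass is put on the payoff `0`.
    have h1 := hD.sum_mem (t := Finset.univ)
      (w := fun o : Option (Fin N) => o.elim (1 - ∑ i, w i / T) fun i => w i / T)
      (z := fun o => o.elim 0 f) ?_ (by simp [Fintype.sum_option]) ?_
    · simpa [Fintype.sum_option] using h1
    · rintro (_ | i) -
      · simpa [← Finset.sum_div] using (div_le_one hT).2 hTw
      · exact hw0 i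
    · rintro (_ | i) -
      · exact h0
      · exact hBD (hf i)
  have hrf : ∀ i, r ((w i / T) • f i) = w i / T * r (f i) := fun i =>
    hr.pos_hom _ (hBD (hf i)) _ (hw0 i) (hBD (hfB i))
  have hld : (l / T) • d ∈ D := hD.smul_mem_of_zero_mem h0 hd
    ⟨by positivity, (div_le_one hT).2 hTl⟩
  have h1 := hc N _ hfB hsumD
  have h2 : ge (((l / T) • d) + fun _ => a / T) (∑ i, (w i / T) • f i) := by
    have := hge.smul h (inv_nonneg.2 hT.le)
    convert this using 1
    · funext ω
      simp only [Pi.add_apply, Pi.smul_apply, smul_eq_mul]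
      field_simp
    · rw [Finset.smul_sum]
      exact Finset.sum_congr rfl fun i _ => by rw [smul_smul, div_eq_inv_mul]
  have h3 : r (∑ i, (w i / T) • f i) ≤ l / T * r d + a / T := by
    rw [← hr.pos_hom d hd _ (by positivity) hld]
    -- `D` is only stable under adding nonnegative cash, so the cash is moved to the side where it
    -- is nonnegative.
    rcases le_total 0 a with ha | ha
    · have ha' := hDa _ hld (a / T) (by positivity)
      rw [← hca _ hld _ ha']
      exact hr.mono _ ha' _ hsumD h2
    · have ha' := hDa _ hsumD (-(a / T)) (neg_nonneg.2 (div_nonpos_of_nonpos_of_nonneg ha hT.le))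
      have h4 := hge.add_right h2 fun _ => -(a / T)
      have h5 : (((l / T) • d) + fun _ => a / T) + (fun _ => -(a / T)) = (l / T) • d := by
        funext ω
        simp
      rw [h5] at h4
      have h6 := hr.mono _ hld _ ha' h4
      rw [hca _ hsumD _ ha'] at h6
      linarith
  have h4 : ∑ i, r ((w i / T) • f i) = (∑ i, w i * r (f i)) / T := by
    rw [Finset.sum_div]
    exact Finset.sum_congr rfl fun i _ => by rw [hrf, div_mul_eq_mul_div]
  rw [h4] at h1
  have h5 := mul_le_mul_of_nonneg_left (h1.trans h3) hT.le
  have h6 : T * (c * ((∑ i, w i * r (f i)) / T)) = c * ∑ i, w i * r (f i) := by field_simp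
  have h7 : T * (l / T * r d + a / T) = l * r d + a := by field_simp
  rw [h6, h7] at h5
  exact h5

lemma exists_linearMap_of_pricing (hge : IsCommonOrder ge) (hX : IsAssetSet ge X)
    (hD : Convex ℝ D) (hXD : X ⊆ D)
    (hDa : ∀ f ∈ D, ∀ a : ℝ, 0 ≤ a → (fun ω => f ω + a) ∈ D) (hr : IsPricing ge D r)
    (hca : CashAdditive D r) (hBD : B ⊆ D)
    (hBs : ∀ f ∈ B, ∀ l : ℝ, 0 ≤ l → l ≤ 1 → l • f ∈ B)
    (hc : ∀ (N : ℕ) (f : Fin N → Ω → ℝ), (∀ i, f i ∈ B) → ∑ i, f i ∈ D →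
      c * ∑ i, r (f i) ≤ r (∑ i, f i)) :
    ∃ φ : (Ω → ℝ) →ₗ[ℝ] ℝ, φ 1 = 1 ∧ (∀ f ∈ X, φ f ≤ r f) ∧
      (∀ f ∈ B, f ∈ superhedgeable ge X → c * r f ≤ φ f) ∧
      ∀ f ∈ superhedgeable ge X, ge f 0 → 0 ≤ φ f := by
  have h0 : (0 : Ω → ℝ) ∈ D := hXD hX.zero_mem
  have hr0 := hr.map_zero h0
  obtain ⟨φ, hφ⟩ := exists_linearMap_le_of_cone (superhedgeableSubmodule hge hX)
    (constraints ge D B r c)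
    ⟨0, h0, 1, one_pos, 0, _, zero_mem_combinations, hge.mono _ _ fun ω => by simp, by simp [hr0]⟩
    (by
      rintro ⟨x, t⟩ ⟨d, hd, l, hl, a, y, hy, hxy, hyt⟩ ⟨x', t'⟩ ⟨d', hd', l', hl', a', y', hy',
        hxy', hyt'⟩
      have hll : 0 < l + l' := add_pos hl hl'
      have hm : (l / (l + l')) • d ∈ D := hD.smul_mem_of_zero_mem h0 hd
        ⟨by positivity, (div_le_one hll).2 (by linarith)⟩
      have hm' : (l' / (l + l')) • d' ∈ D := hD.smul_mem_of_zero_mem h0 hd'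
        ⟨by positivity, (div_le_one hll).2 (by linarith)⟩
      have hmm : (l / (l + l')) • d + (l' / (l + l')) • d' ∈ D :=
        hD hd hd' (by positivity) (by positivity) (by field_simp)
      refine ⟨_, hmm, l + l', hll, a + a', y + y', add_mem_combinations hy hy', ?_, ?_⟩
      · convert hge.add hxy hxy' using 1
        · funext ω
          simp only [Pi.add_apply, Pi.smul_apply, smul_eq_mul]
          field_simp
          ring
        · simp only [Prod.fst_add]
          abel
      · have h1 := hr.subadd _ hm _ hm' hmm
        rw [hr.pos_hom d hd _ (by positivity) hm, hr.pos_hom d' hd' _ (by positivity) hm'] at h1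
        have h2 := mul_le_mul_of_nonneg_left h1 hll.le
        have h3 : (l + l') * (l / (l + l') * r d + l' / (l + l') * r d') = l * r d + l' * r d' := by
          field_simp
        rw [h3] at h2
        simp only [Prod.mk_add_mk, Prod.snd_add] at hyt hyt' ⊢
        linarith)
    (by
      rintro ⟨x, t⟩ ⟨d, hd, l, hl, a, y, hy, hxy, hyt⟩ k hk
      refine ⟨d, hd, k * l, mul_pos hk hl, k * a, k • y, smul_mem_combinations hy hk.le, ?_, ?_⟩
      · convert hge.smul hxy hk.le using 1
        · funext ω
          simp only [Pi.add_apply, Pi.smul_apply, smul_eq_mul]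
          ring
        · simp [smul_add]
      · have := mul_le_mul_of_nonneg_left hyt hk.le
        simp only [Prod.smul_mk, Prod.smul_snd, smul_eq_mul] at this ⊢
        linarith)
    (by
      rintro t ⟨d, hd, l, hl, a, y, hy, hxy, hyt⟩
      rw [zero_add] at hxy
      have := combinations_le hge hD h0 hDa hr hca hBD hBs hc hy hd hl hxy
      simp only at hyt
      linarith)
    (by
      rintro x ⟨l, hl, d, hd, hdx⟩
      refine ⟨_, d, hXD hd, l, hl, 0, _, zero_mem_combinations, ?_, le_rfl⟩
      exact hge.trans _ (fun ω => |x ω|) _ (hge.trans _ _ _ (hge.mono _ _ fun ω => by simp) hdx)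
        (hge.mono _ _ fun ω => by simpa using le_abs_self (x ω)))
  have hone : ∀ a : ℝ, φ (fun _ => a) ≤ a := fun a =>
    hφ _ (const_mem_superhedgeable hge hX a) _ ⟨0, h0, 1, one_pos, a, _, zero_mem_combinations,
      hge.mono _ _ fun ω => by simp, by simp [hr0]⟩
  -- Each property is one constraint: cash alone, `d = f` for `φ f ≤ r f`, the combination `(f, r
  -- f)` against `-f` for `c * r f ≤ φ f`, and the zero hedge of `-f` for positivity.
  refine ⟨φ, le_antisymm (hone 1) ?_, fun f hf => ?_, fun f hf hfX => ?_, fun f hf hf0 => ?_⟩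
  · have h1 := hone (-1)
    have h2 : (fun _ : Ω => (-1 : ℝ)) = -1 := rfl
    rw [h2, map_neg] at h1
    linarith
  · exact hφ f (subset_superhedgeable hge hX hf) _ ⟨f, hXD hf, 1, one_pos, 0, _,
      zero_mem_combinations, hge.mono _ _ fun ω => by simp, by simp⟩
  · have := hφ (-f) ((superhedgeableSubmodule hge hX).neg_mem hfX) (-(c * r f))
      ⟨0, h0, 1, one_pos, 0, _, mem_combinations hf, hge.mono _ _ fun ω => by simp, by simp [hr0]⟩
    rw [map_neg] at this
    linarith
  · have := hφ (-f) ((superhedgeableSubmodule hge hX).neg_mem hf) 0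
      ⟨0, h0, 1, one_pos, 0, _, zero_mem_combinations,
        by convert hge.add_right hf0 (-f) using 1 <;> (funext ω; simp), by simp [hr0]⟩
    rw [map_neg] at this
    linarith

/-! ### ### From the linear functional to a pricing measure -/

/-- The finitely additive set function of a linear functional. -/
noncomputable def contentOfLinearMap (φ : (Ω → ℝ) →ₗ[ℝ] ℝ) : AddContent ℝ (Set.univ : Set (Set Ω)) where
  toFun A := φ (A.indicator 1)
  empty' := by rw [Set.indicator_empty']; exact map_zero φ
  sUnion' I _ hI _ := by
    rw [← map_sum]
    congr 1
    funext ω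
    rw [Finset.sum_apply]
    by_cases h : ∃ A ∈ I, ω ∈ A
    · obtain ⟨A, hA, hω⟩ := h
      rw [Finset.sum_eq_single A]
      · simp only [Set.indicator, Set.mem_sUnion, Finset.mem_coe]
        rw [if_pos ⟨A, hA, hω⟩, if_pos hω]
      · intro A' hA' hne
        exact Set.indicator_of_notMem (fun hω' =>
          Set.disjoint_left.1 (hI hA' hA hne) hω' hω) _
      · exact fun h => absurd hA h
    · rw [Finset.sum_eq_zero fun A hA => Set.indicator_of_notMem (fun hω => h ⟨A, hA, hω⟩) _]
      exact Set.indicator_of_notMem (by simpa using h) _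

lemma exists_strictPricingMeasure_of_functional (hge : IsCommonOrder ge) (hX : IsAssetSet ge X)
    (hr : IsPricing ge (convexHull ℝ (callOverwriting X)) r)
    (hna : NoArbitrage ge (callOverwriting X) r)
    (hca : CashAdditive (convexHull ℝ (callOverwriting X)) r) (hrp : ∀ f ∈ X, r f ≤ p f)
    (hmp : marketPower ge (convexHull ℝ (callOverwriting X)) (callOverwriting X) r < 1) :
    (strictPricingMeasures ge X p (callOverwriting X)).Nonempty := by
  set D := convexHull ℝ (callOverwriting X) with hDdef
  set B : Set (Ω → ℝ) := {f | f ∈ callOverwriting X ∧ ge f 0 ∧ ∃ c : ℝ, ge (fun _ => c) f} with hB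
  have hsub : callOverwriting X ⊆ D := subset_convexHull ℝ _
  have h0 : (0 : Ω → ℝ) ∈ D := hsub (Or.inl hX.zero_mem)
  have hr0 := hr.map_zero h0
  have hpos : ∀ f ∈ D, ge f 0 → 0 ≤ r f := fun f hf h => by
    simpa [hr0] using hr.mono f hf 0 h0 h
  have hc : ∀ (N : ℕ) (f : Fin N → Ω → ℝ), (∀ i, f i ∈ B) → ∑ i, f i ∈ D →
      (1 - marketPower ge D (callOverwriting X) r) * ∑ i, r (f i) ≤ r (∑ i, f i) := by
    intro N f hf hfD
    have hs : 0 ≤ ∑ i, r (f i) := Finset.sum_nonneg fun i _ => hpos _ (hsub (hf i).1) (hf i).2.1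
    have hle : (∑ i, r (f i) - r (∑ i, f i)) / ∑ i, r (f i)
        ≤ marketPower ge D (callOverwriting X) r := by
      -- A real `sSup` bounds its members only if the set is bounded; the ratios are at most `1`
      -- because the price of the positive sum is nonnegative.
      refine le_csSup ⟨1, ?_⟩ ⟨N, f, hf, hfD, rfl⟩
      rintro x ⟨M, g, hg, hgD, rfl⟩
      refine div_le_one_of_le₀ ?_
        (Finset.sum_nonneg fun i _ => hpos _ (hsub (hg i).1) (hg i).2.1)
      linarith [hpos _ hgD (hge.sum_nonneg _ fun i _ => (hg i).2.1)]
    -- When the denominator is zero the ratio carries no information, and the bound is just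
    -- positivity of `r`.
    rcases hs.eq_or_lt with hs | hs
    · rw [← hs, mul_zero]
      exact hpos _ hfD (hge.sum_nonneg _ fun i _ => (hf i).2.1)
    · rw [div_le_iff₀ hs] at hle
      linarith
  obtain ⟨φ, hφ1, hφX, hφB, hφ0⟩ := exists_linearMap_of_pricing (B := B) hge hX
    (convex_convexHull ℝ _) (fun f hf => hsub (Or.inl hf))
    (fun f hf a ha => add_const_mem_convexHull hX hf ha) hr hca (fun f hf => hsub hf.1)
    (by
      rintro f ⟨hf, hf0, k, hk⟩ l hl0 hl1
      refine ⟨smul_mem_callOverwriting hX hf hl0 hl1, ?_, l * k, hge.smul hk hl0⟩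
      simpa using hge.smul hf0 hl0) hc
  have hmono : ∀ f ∈ superhedgeable ge X, ∀ g ∈ superhedgeable ge X, ge f g → φ g ≤ φ f := by
    intro f hf g hg hfg
    have := hφ0 _ ((superhedgeableSubmodule hge hX).sub_mem hf hg) (hge.sub_nonneg hfg)
    rw [map_sub] at this
    linarith
  set m := contentOfLinearMap φ with hmdef
  have hmA : ∀ A : Set Ω, φ (A.indicator 1) = m A := fun A => rfl
  have hind : ∀ A : Set Ω, A.indicator 1 ∈ superhedgeable ge X := fun A =>
    superhedgeable_of_bounded hge hX (c := 1) fun ω => by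
      by_cases h : ω ∈ A <;> simp [h]
  have hm : IsFinAddProb m := by
    refine ⟨fun A => hφ0 _ (hind A) (hge.mono _ _ fun ω => ?_), ?_⟩
    · exact Set.indicator_nonneg (fun _ _ => zero_le_one) ω
    · rw [← hmA, Set.indicator_univ, hφ1]
  have hn : ∀ A ∈ negligible ge, m A = 0 := fun A hA => by
    refine le_antisymm ?_ (hm.1 A)
    rw [← hmA, ← map_zero φ]
    exact hmono 0 ((superhedgeableSubmodule hge hX).zero_mem) _ (hind A) hA
  have hsL : ∀ s : Ω → ℝ, (Set.range s).Finite → s ∈ superhedgeable ge X := fun s hs => by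
    obtain ⟨k, -, hk⟩ := exists_bound_of_finite_range (hs.image abs |> fun h =>
      (by rwa [← Set.range_comp] at h : (Set.range (abs ∘ s)).Finite))
    exact superhedgeable_of_bounded hge hX hk
  have hle : ∀ f ∈ superhedgeable ge X, ∀ s : Ω → ℝ, (Set.range s).Finite →
      (∀ ω, s ω ≤ f ω) → simpleIntegral m s ≤ φ f := fun f hf s hs hsf => by
    rw [simpleIntegral_eq_of_indicator φ hmA hs]
    exact hmono _ hf _ (hsL s hs) (hge.mono _ _ hsf)
  have habs : ∀ f ∈ superhedgeable ge X, (fun ω => |f ω|) ∈ superhedgeable ge X := fun f hf =>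
    superhedgeable_of_abs_le hge hf fun ω => by simp
  have hL : ∀ f ∈ superhedgeable ge X, IntegrableFA m f := by
    intro f hf
    refine ⟨φ fun ω => |f ω|, ?_⟩
    rintro x ⟨s, hs, -, hsf, rfl⟩
    exact hle _ (habs f hf) s hs hsf
  have hposL : ∀ f ∈ superhedgeable ge X, (fun ω => max (f ω) 0) ∈ superhedgeable ge X :=
    fun f hf => superhedgeable_of_abs_le hge hf fun ω => by
      rw [abs_of_nonneg (le_max_right _ _)]
      exact max_le (le_abs_self _) (abs_nonneg _)
  -- Only an inequality: simple functions below `f` recover the integral but possibly not all of `φ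
  -- f`. The negative part of `f` is null, so `f` and its positive part can be exchanged.
  have hint : ∀ f ∈ superhedgeable ge X, ge f 0 → integralFA m f ≤ φ f ∧
      integralFA m f = lowerIntegral m fun ω => max (f ω) 0 := by
    intro f hf hf0
    have h1 : integralFA m f = lowerIntegral m fun ω => max (f ω) 0 := by
      change lowerIntegral m _ - lowerIntegral m _ = _
      rw [lowerIntegral_eq_zero_of_ge hge hm hn (fun ω => le_max_right _ _) (hge.neg_part hf0),
        sub_zero]
    refine ⟨?_, h1⟩
    rw [h1]
    refine (lowerIntegral_le hm (fun ω => le_max_right _ _) fun s hs _ hsf =>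
      hle _ (hposL f hf) s hs hsf).trans (hmono _ hf _ (hposL f hf) ?_)
    have h2 := hge.add_right (hge.neg_part hf0) f
    refine hge.trans _ _ _ (by simpa using h2) (hge.mono _ _ fun ω => ?_)
    simp only [Pi.add_apply]
    linarith [max_zero_sub_max_neg_zero (f ω)]
  refine ⟨m, ⟨hm, hn, hL, fun f hf => ?_⟩, fun f hf hf0 => ?_⟩
  · refine le_trans ?_ ((hφX f hf).trans (hrp f hf))
    -- Subtracting the lower cash bound makes the payoff positive for the order; the constant is
    -- valued equally by `φ` and by the integral.
    obtain ⟨a, ha⟩ := hX.bounded_below f hf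
    have hfL := subset_superhedgeable hge hX hf
    have haL := const_mem_superhedgeable hge hX a
    have h1 := (hint _ ((superhedgeableSubmodule hge hX).sub_mem hfL haL)
      (hge.sub_nonneg ha)).1
    have h2 : φ (fun _ => a) = a := by
      have h3 : (fun _ : Ω => a) = a • (1 : Ω → ℝ) := by
        funext ω
        simp
      rw [h3, map_smul, hφ1, smul_eq_mul, mul_one]
    rw [map_sub, h2, sub_eq_add_neg, integralFA_add hm (hL f hfL) (hL _ haL).neg, integralFA_neg,
      integralFA_const hm] at h1
    linarith
  · have hg := inf_one_mem_callOverwriting hf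
    have hg0 := hge.trunc f hf0
    have hgL := callOverwriting_subset hge hX hg
    have hgle : ∀ ω, (f ⊓ 1) ω ≤ 1 := fun ω => min_le_right _ _
    have h1 : 0 < φ (f ⊓ 1) :=
      (mul_pos (sub_pos.2 hmp) (hna _ hg hg0)).trans_le
        (hφB _ ⟨hg, hg0.1, 1, hge.mono _ _ hgle⟩ hgL)
    have h2 := hmono _ (hposL _ hgL) _ hgL (hge.mono _ _ fun ω => le_max_left _ _)
    rw [(hint _ hgL hg0.1).2]
    -- The positive part of `f ⊓ 1` lies in `[0, 1]`, hence within `ε` of a simple function, on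
    -- which `φ` and the integral agree.
    refine h1.trans_le (h2.trans (le_of_forall_pos_le_add fun ε hε => ?_))
    obtain ⟨s, hs, hs0, hsf, hsn⟩ := exists_simple_approx
      (f := fun ω => max ((f ⊓ 1) ω) 0) (fun ω => le_max_right _ _) zero_le_one hε
    have h3 := simpleIntegral_le_lowerIntegral (hL _ hgL).bddAbove_pos hs hs0 hsf
    have hsε := finite_range_add hs (finite_range_const ε)
    have h4 : φ (fun ω => max ((f ⊓ 1) ω) 0) ≤ φ (s + fun _ => ε) :=
      hmono _ (hsL _ hsε) _ (hposL _ hgL) (hge.mono _ _ fun ω => by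
        have := hsn ω
        rwa [min_eq_left (max_le (hgle ω) zero_le_one)] at this)
    rw [← simpleIntegral_eq_of_indicator φ hmA hsε, simpleIntegral_add hs (finite_range_const ε),
      simpleIntegral_const hm] at h4
    linarith

end CommonOrderMarket

open CommonOrderMarket in
theorem mainTheorem10 {Ω : Type*} (ge : (Ω → ℝ) → (Ω → ℝ) → Prop) (hge : IsCommonOrder ge)
    (X : Set (Ω → ℝ)) (hX : IsAssetSet ge X) (p : (Ω → ℝ) → ℝ) (hp : IsPrice ge X p) :
    (Convex ℝ (callOverwriting X) →
      ((strictPricingMeasures ge X p (callOverwriting X)).Nonempty ↔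
        ∃ r : (Ω → ℝ) → ℝ,
          IsPrice ge (callOverwriting X) r ∧
          CashAdditive (callOverwriting X) r ∧
          (∀ f ∈ X, r f ≤ p f) ∧
          marketPower ge (callOverwriting X) (callOverwriting X) r < 1)) ∧
    ((strictPricingMeasures ge X p (callOverwriting X)).Nonempty ↔
      ∃ r : (Ω → ℝ) → ℝ,
        IsPricing ge (convexHull ℝ (callOverwriting X)) r ∧
        NoArbitrage ge (callOverwriting X) r ∧
        CashAdditive (convexHull ℝ (callOverwriting X)) r ∧
        (∀ f ∈ X, r f ≤ p f) ∧
        marketPower ge (convexHull ℝ (callOverwriting X)) (callOverwriting X) r < 1) := by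
  have h : (strictPricingMeasures ge X p (callOverwriting X)).Nonempty ↔
      ∃ r : (Ω → ℝ) → ℝ,
        IsPricing ge (convexHull ℝ (callOverwriting X)) r ∧
        NoArbitrage ge (callOverwriting X) r ∧
        CashAdditive (convexHull ℝ (callOverwriting X)) r ∧
        (∀ f ∈ X, r f ≤ p f) ∧
        marketPower ge (convexHull ℝ (callOverwriting X)) (callOverwriting X) r < 1 :=
    ⟨exists_functional_of_strictPricingMeasures hge hX, fun ⟨r, h1, h2, h3, h4, h5⟩ =>
      exists_strictPricingMeasure_of_functional hge hX h1 h2 h3 h4 h5⟩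
  refine ⟨fun hconv => ?_, h⟩
  -- A convex `callOverwriting X` is its own convex hull, so the general case specialises.
  rw [hconv.convexHull_eq] at h
  simpa only [IsPrice, and_assoc] using h
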